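/- All graphs are finite and simple. A graph is 1-planar if it can be drawn in the plane with every edge crossed at most once; it is optimal 1-planar if it is 1-planar and has $n\ge 3$ vertices and $4n-8$ edges. For $k\ge 3$ the extended wheel graph $XW_{2k}$ consists of a cycle of length $2k$, the edges between vertices at distance two on the cycle, and two non-adjacent poles, each adjacent to every vertex of the cycle. The two (feasible) reductions of a graph $G$ are the following; their results are taken up to isomorphism. SR: let $x$ be a vertex of degree six with neighbours $x_1,\dots,x_6$ such that $x_1x_2,\,x_2x_3,\dots,x_5x_6,\,x_6x_1$ and $x_1x_3,\,x_3x_5,\,x_5x_1$ are edges and $x_2x_4,\ x_6x_4,\ x_1x_4$ are not edges. Remove $x$ and the edge $x_3x_5$, and add the edges $x_4x_1,\ x_4x_2,\ x_4x_6$. CR: let $x_1,\dots,x_4,v_1,\dots,v_4$ be distinct vertices such that, with indices modulo $4$, the neighbours of $x_i$ are exactly the other three $x_j$ and $v_{i-1},v_i,v_{i+1}$, each $v_iv_{i+1}$ is an edge, and $v_1v_3,\ v_2v_4$ are not edges. Remove $x_1,\dots,x_4$ and add the edges $v_1v_3,\ v_2v_4$. The reduction system with a given set of rules on a class $\mathcal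 C$ of graphs has a step $G\to G'$ whenever $G,G'\in\mathcal C$ and $G'$ is obtained from $G$ by one of the rules; $\to^*$ is the reflexive transitive closure. The system is confluent if $X\to^* U$ and $X\to^* W$ always imply that $U$ and $W$ have, up to isomorphism, a common descendant $Z$, that is, $U\to^* Z$ and $W\to^* Z$. A graph is irreducible for a set of rules if none of the rules can be applied to it. Corollary. (1) The reduction system with the rules $\{SR,CR\}$ on the optimal 1-planar graphs is not confluent. (2) The reduction system with the single rule $SR$ on the 5-connected optimal 1-planar graphs is not confluent. Moreover, in each of the two systems there is a graph $G$ of the class with $G\to^* XW_{2k}$ and $G\to^* XW_{2l}$ for two non-isomorphic extended wheel graphs $XW_{2k}$, $XW_{2l}$ ($k,l\ge 3$) that are irreducible for the rules of the system. -/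

import Mathlib

open Set

namespace OnePlanarReduction

/-- A finite simple undirected graph. -/
structure FinGraph where
  V : Type
  finite : Finite V
  graph : SimpleGraph V

/-- Two finite graphs are isomorphic. -/
def FinGraph.Iso (G H : FinGraph) : Prop := Nonempty (G.graph ≃g H.graph)

/-- A drawing of `G` in the plane: distinct vertices are placed at distinct points, every edge `e`
is drawn as a simple curve `curve e` (parametrized by `[0, 1]`) that joins the points of its two
ends, and no edge passes through a vertex in its interior. The values of `curve` on pairs that are
not edges play no role. -/
structure IsDrawing {V : Type} (G : SimpleGraph V) (pos : V → ℝ × ℝ)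
    (curve : Sym2 V → ℝ → ℝ × ℝ) : Prop where
  pos_injective : Function.Injective pos
  continuousOn : ∀ e ∈ G.edgeSet, ContinuousOn (curve e) (Icc 0 1)
  injOn : ∀ e ∈ G.edgeSet, InjOn (curve e) (Icc 0 1)
  ends : ∀ e ∈ G.edgeSet, s(curve e 0, curve e 1) = Sym2.map pos e
  interior : ∀ e ∈ G.edgeSet, ∀ t ∈ Ioo (0 : ℝ) 1, ∀ v : V, curve e t ≠ pos v

/-- The crossings on the edge `e` in a drawing: the pairs `(f, P)` of another edge `f` and
a point `P` that is interior to both curves. -/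
def crossings {V : Type} (G : SimpleGraph V) (curve : Sym2 V → ℝ → ℝ × ℝ) (e : Sym2 V) :
    Set (Sym2 V × (ℝ × ℝ)) :=
  {c | c.1 ∈ G.edgeSet ∧ c.1 ≠ e ∧ c.2 ∈ curve e '' Ioo 0 1 ∧ c.2 ∈ curve c.1 '' Ioo 0 1}

/-- `G` can be drawn in the plane so that every edge is crossed at most once. -/
def IsOnePlanar {V : Type} (G : SimpleGraph V) : Prop :=
  ∃ (pos : V → ℝ × ℝ) (curve : Sym2 V → ℝ → ℝ × ℝ),
    IsDrawing G pos curve ∧ ∀ e ∈ G.edgeSet, (crossings G curve e).Subsingleton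

/-- Optimal 1-planar graphs: 1-planar graphs with `n ≥ 3` vertices and `4 n - 8` edges. -/
def IsOptimalOnePlanar (G : FinGraph) : Prop :=
  IsOnePlanar G.graph ∧ 3 ≤ Nat.card G.V ∧ G.graph.edgeSet.ncard + 8 = 4 * Nat.card G.V

/-- `k`-connectivity: there are more than `k` vertices, and the removal of fewer than `k` vertices
never disconnects the graph. -/
def IsVertexConnected (k : ℕ) (G : FinGraph) : Prop :=
  k < Nat.card G.V ∧ ∀ S : Set G.V, S.ncard < k → (G.graph.induce Sᶜ).Connected

/-- The 5-connected optimal 1-planar graphs. -/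
def IsFiveConnectedOptimal (G : FinGraph) : Prop :=
  IsOptimalOnePlanar G ∧ IsVertexConnected 5 G

/-- The extended wheel graph `XW_{2k}` (meant for `k ≥ 3`): a cycle of length `2k` (`Sum.inl i`),
the edges between vertices at distance two on the cycle, and two non-adjacent poles
(`Sum.inr b`) that are adjacent to all vertices of the cycle. -/
def extendedWheelGraph (k : ℕ) : SimpleGraph (Fin (2 * k) ⊕ Bool) :=
  SimpleGraph.fromRel fun a b =>
    match a, b with
    | Sum.inl i, Sum.inl j => j.val = (i.val + 1) % (2 * k) ∨ j.val = (i.val + 2) % (2 * k)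
    | Sum.inl _, Sum.inr _ => True
    | Sum.inr _, _ => False

/-- `XW_{2k}` as a finite graph. -/
def XW (k : ℕ) : FinGraph where
  V := Fin (2 * k) ⊕ Bool
  finite := inferInstance
  graph := extendedWheelGraph k

/-- The crossed star `CS` is matched at `x`: the vertex `x` has exactly the six neighbours
`y 0, …, y 5` (so `x` has degree six), which form a hexagon in this circular order, and
`y 0, y 2, y 4` form a triangle. In the embedding, `x` is the common vertex of the three kites
`(x, y 0, y 1, y 2)`, `(x, y 2, y 3, y 4)`, `(x, y 4, y 5, y 0)`; the edges from `x` to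
`y 0, y 2, y 4` are planar and those to `y 1, y 3, y 5` are crossed by the edges of the triangle. -/
structure IsCrossedStar {V : Type} (G : SimpleGraph V) (x : V) (y : Fin 6 → V) : Prop where
  injective : Function.Injective y
  neighbors : G.neighborSet x = range y
  hexagon : ∀ i, G.Adj (y i) (y (i + 1))
  triangle : G.Adj (y 0) (y 2) ∧ G.Adj (y 2) (y 4) ∧ G.Adj (y 4) (y 0)

/-- Feasibility of `SR(x ↦ y 3)`: there is no blocking red edge and no blocking black edge. -/
def SRFeasible {V : Type} (G : SimpleGraph V) (y : Fin 6 → V) : Prop :=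
  ¬ G.Adj (y 1) (y 3) ∧ ¬ G.Adj (y 5) (y 3) ∧ ¬ G.Adj (y 0) (y 3)

/-- The result of `SR(x ↦ y 3)`: `x` is removed (merged with `y 3`) and the three kites are replaced
by the two kites `(y 3, y 0, y 1, y 2)` and `(y 3, y 4, y 5, y 0)`. So the edge `y 2 y 4`
disappears and `y 3` gets the new neighbours `y 0, y 1, y 5`. -/
def srResult {V : Type} (G : SimpleGraph V) (x : V) (y : Fin 6 → V) :
    SimpleGraph ↥({x}ᶜ : Set V) :=
  ((G \ SimpleGraph.edge (y 2) (y 4)) ⊔ SimpleGraph.edge (y 3) (y 0) ⊔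
    SimpleGraph.edge (y 3) (y 1) ⊔ SimpleGraph.edge (y 3) (y 5)).induce {x}ᶜ

/-- `G` reduces to `H` by a feasible `SR`-reduction (`H` is determined up to isomorphism). -/
def SRStep (G H : FinGraph) : Prop :=
  ∃ (x : G.V) (y : Fin 6 → G.V), IsCrossedStar G.graph x y ∧ SRFeasible G.graph y ∧
    Nonempty (H.graph ≃g srResult G.graph x y)

/-- The crossed cube `CC` is matched with inner cycle `x 0, …, x 3` and outer cycle `v 0, …, v 3`:
the inner vertices have degree six, `x i` is adjacent to the other three inner vertices and
to `v (i - 1), v i, v (i + 1)`, and consecutive vertices of the outer cycle are adjacent. -/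
structure IsCrossedCube {V : Type} (G : SimpleGraph V) (x v : Fin 4 → V) : Prop where
  injective_inner : Function.Injective x
  injective_outer : Function.Injective v
  disjoint : Disjoint (range x) (range v)
  neighbors : ∀ i, G.neighborSet (x i) =
    {x (i + 1), x (i + 2), x (i + 3)} ∪ {v (i - 1), v i, v (i + 1)}
  outer : ∀ i, G.Adj (v i) (v (i + 1))

/-- Feasibility of `CR(x 0, x 1, x 2, x 3)`: the diagonals of the outer cycle are missing. -/
def CRFeasible {V : Type} (G : SimpleGraph V) (v : Fin 4 → V) : Prop :=
  ¬ G.Adj (v 0) (v 2) ∧ ¬ G.Adj (v 1) (v 3)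

/-- The result of `CR(x 0, x 1, x 2, x 3)`: the inner cycle is removed and the outer cycle becomes
a kite. -/
def crResult {V : Type} (G : SimpleGraph V) (x v : Fin 4 → V) :
    SimpleGraph ↥((range x)ᶜ : Set V) :=
  (G ⊔ SimpleGraph.edge (v 0) (v 2) ⊔ SimpleGraph.edge (v 1) (v 3)).induce (range x)ᶜ

/-- `G` reduces to `H` by a feasible `CR`-reduction (`H` is determined up to isomorphism). -/
def CRStep (G H : FinGraph) : Prop :=
  ∃ x v : Fin 4 → G.V, IsCrossedCube G.graph x v ∧ CRFeasible G.graph v ∧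
    Nonempty (H.graph ≃g crResult G.graph x v)

/-- One step of the system with the two rules `SR` and `CR`. -/
def SRCRStep (G H : FinGraph) : Prop := SRStep G H ∨ CRStep G H

/-- The reduction system `step` on the class `C` of graphs: `G` and `H` both belong to `C`. -/
def stepOn (C : FinGraph → Prop) (step : FinGraph → FinGraph → Prop) (G H : FinGraph) : Prop :=
  C G ∧ C H ∧ step G H

/-- A graph is irreducible if no reduction step applies to it. -/
def IsIrreducible (step : FinGraph → FinGraph → Prop) (G : FinGraph) : Prop :=
  ∀ H, ¬ step G H

/-- Confluence of a graph reduction system; as usual for graphs, the common descendant is only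
required to be common up to isomorphism. -/
def IsConfluent (step : FinGraph → FinGraph → Prop) : Prop :=
  ∀ X U W : FinGraph, Relation.ReflTransGen step X U → Relation.ReflTransGen step X W →
    ∃ Z Z' : FinGraph, Relation.ReflTransGen step U Z ∧ Relation.ReflTransGen step W Z' ∧ Z.Iso Z'

end OnePlanarReduction

/-! One graph refutes confluence of both systems: a 5-connected optimal 1-planar graph on 13
vertices. A single SR turns it into `XW 5`, that is $XW_{10}$, while three other SRs lead through
graphs on 12 and 11 vertices to `XW 4`, that is $XW_8$. Both wheels are irreducible for SR and CR,
so each is its own only descendant, and their vertex numbers differ (`not_isConfluent`). All graphs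
on the two paths are 5-connected and all steps are SRs, so the same paths serve the larger system.

Irreducibility comes from local obstructions (`not_srStep`, `not_crStep`), which are finite checks
on the wheels.

Membership in the class is reduced to finite computation. For 1-planarity, each graph is drawn with
integer vertices and edges of one or two segments; signs of orientation determinants certify that
each edge has at most one crossing (`IsOnePlanarRouting.isOnePlanar`). For 5-connectivity, a search
runs over all deletions of at most four vertices, with vertex sets coded as bit masks
(`isVertexConnected_of_mask`). -/

namespace OnePlanarReduction

/-! ### Polygonal drawings with integer coordinates -/

/-- Twice the signed area of the triangle `p q r`. -/
def orient (p q r : ℤ × ℤ) : ℤ := (q.1 - p.1) * (r.2 - p.2) - (q.2 - p.2) * (r.1 - p.1)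

/-- Twice the signed area of the triangle `p q r`. -/
noncomputable def orientReal (p q r : ℝ × ℝ) : ℝ :=
  (q.1 - p.1) * (r.2 - p.2) - (q.2 - p.2) * (r.1 - p.1)

/-- An integer point as a point of the plane. -/
def toPlane (p : ℤ × ℤ) : ℝ × ℝ := ((p.1 : ℝ), (p.2 : ℝ))

theorem toPlane_injective : Function.Injective toPlane := by
  intro p q h
  simp only [toPlane, Prod.mk.injEq, Int.cast_inj] at h
  exact Prod.ext h.1 h.2

theorem orientReal_toPlane (p q r : ℤ × ℤ) :
    orientReal (toPlane p) (toPlane q) (toPlane r) = (orient p q r : ℝ) := by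
  simp [orientReal, orient, toPlane]

/-- The affine parametrization of the segment from `p` to `q`. -/
noncomputable def seg (p q : ℝ × ℝ) (t : ℝ) : ℝ × ℝ :=
  (p.1 + t * (q.1 - p.1), p.2 + t * (q.2 - p.2))

theorem seg_zero (p q : ℝ × ℝ) : seg p q 0 = p := by simp [seg]

theorem seg_one (p q : ℝ × ℝ) : seg p q 1 = q := by simp [seg]

theorem continuous_seg (p q : ℝ × ℝ) : Continuous (seg p q) := by
  unfold seg; fun_prop

theorem seg_injective {p q : ℝ × ℝ} (h : p ≠ q) : Function.Injective (seg p q) := by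
  intro t u htu
  simp only [seg, Prod.mk.injEq, add_right_inj, mul_eq_mul_right_iff] at htu
  by_contra hne
  exact h (Prod.ext (by linarith [htu.1.resolve_left hne]) (by linarith [htu.2.resolve_left hne]))

theorem orientReal_seg (p q r s : ℝ × ℝ) (t : ℝ) :
    orientReal p q (seg r s t) = (1 - t) * orientReal p q r + t * orientReal p q s := by
  simp only [orientReal, seg]; ring

theorem orientReal_seg_self (p q : ℝ × ℝ) (t : ℝ) : orientReal p q (seg p q t) = 0 := by
  simp only [orientReal, seg]; ring

/-- The parametrized path from `p` to `q`: a segment, or two segments through a bend. -/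
noncomputable def path (p q : ℝ × ℝ) : Option (ℝ × ℝ) → ℝ → ℝ × ℝ
  | none => seg p q
  | some m => fun t => if t ≤ 1 / 2 then seg p m (2 * t) else seg m q (2 * t - 1)

theorem path_zero (p q : ℝ × ℝ) (m : Option (ℝ × ℝ)) : path p q m 0 = p := by
  cases m <;> simp [path, seg_zero]

theorem path_one (p q : ℝ × ℝ) (m : Option (ℝ × ℝ)) : path p q m 1 = q := by
  cases m with
  | none => simp [path, seg_one]
  | some m =>
    have h : ¬ (1 : ℝ) ≤ 2⁻¹ := by norm_num
    have h2 : (2 : ℝ) - 1 = 1 := by norm_num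
    simp [path, h, h2, seg_one]

theorem continuous_path (p q : ℝ × ℝ) (m : Option (ℝ × ℝ)) : Continuous (path p q m) := by
  cases m with
  | none => exact continuous_seg p q
  | some m =>
    refine Continuous.if_le ((continuous_seg p m).comp (by fun_prop))
      ((continuous_seg m q).comp (by fun_prop)) continuous_id continuous_const ?_
    rintro t rfl
    norm_num [seg_one, seg_zero]

theorem injOn_path_none {p q : ℝ × ℝ} (h : p ≠ q) : InjOn (path p q none) (Icc 0 1) :=
  (seg_injective h).injOn

/-- The second segment meets the line through `p` and `m` only at the bend `m`, which belongs to the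
first segment at parameter 1/2. So the two halves share no point at different parameters. -/
theorem injOn_path_some {p q m : ℝ × ℝ} (h : orientReal p m q ≠ 0) :
    InjOn (path p q (some m)) (Icc 0 1) := by
  have hpm : p ≠ m := by rintro rfl; simp [orientReal] at h
  have hmq : m ≠ q := by rintro rfl; apply h; simp only [orientReal]; ring
  have hm : orientReal p m m = 0 := by simp only [orientReal]; ring
  have mixed : ∀ t u : ℝ, ¬ u ≤ 1 / 2 → seg p m (2 * t) ≠ seg m q (2 * u - 1) := by
    intro t u hu e
    have e' := congrArg (orientReal p m) e
    rw [orientReal_seg_self, orientReal_seg, hm, mul_zero, zero_add] at e'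
    rcases mul_eq_zero.1 e'.symm with h' | h'
    · exact hu (by linarith)
    · exact h h'
  intro t _ u _ htu
  simp only [path] at htu
  split_ifs at htu with h1 h2 h2
  · linarith [seg_injective hpm htu]
  · exact (mixed _ _ h2 htu).elim
  · exact (mixed _ _ h1 htu.symm).elim
  · linarith [seg_injective hmq htu]

/-- The segments of a path with integer ends. -/
def pieces (p q : ℤ × ℤ) : Option (ℤ × ℤ) → List ((ℤ × ℤ) × (ℤ × ℤ))
  | none => [(p, q)]
  | some m => [(p, m), (m, q)]

/-- The point `P` lies on the segment `A`. -/
def OnPiece (A : (ℤ × ℤ) × (ℤ × ℤ)) (P : ℝ × ℝ) : Prop :=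
  ∃ t ∈ Icc (0 : ℝ) 1, P = seg (toPlane A.1) (toPlane A.2) t

theorem exists_piece (p q : ℤ × ℤ) (m : Option (ℤ × ℤ)) {t : ℝ} (ht : t ∈ Icc (0 : ℝ) 1) :
    ∃ A ∈ pieces p q m, OnPiece A (path (toPlane p) (toPlane q) (m.map toPlane) t) := by
  obtain ⟨h0, h1⟩ := ht
  cases m with
  | none => exact ⟨(p, q), by simp [pieces], t, ⟨h0, h1⟩, rfl⟩
  | some m =>
    by_cases h : t ≤ 1 / 2
    · refine ⟨(p, m), by simp [pieces], 2 * t, ⟨by linarith, by linarith⟩, ?_⟩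
      simp only [Option.map_some, path, if_pos h]
    · refine ⟨(m, q), by simp [pieces], 2 * t - 1, ⟨by linarith, by linarith⟩, ?_⟩
      simp only [Option.map_some, path, if_neg h]

theorem OnPiece.orientReal_eq_zero {A : (ℤ × ℤ) × (ℤ × ℤ)} {P : ℝ × ℝ} (h : OnPiece A P) :
    orientReal (toPlane A.1) (toPlane A.2) P = 0 := by
  obtain ⟨t, _, rfl⟩ := h
  exact orientReal_seg_self _ _ _

/-- The segment `B` lies strictly on one side of the line through `A`, except possibly for
an end that is a vertex. -/
def OneSided {n : ℕ} (pos : Fin n → ℤ × ℤ) (A B : (ℤ × ℤ) × (ℤ × ℤ)) : Prop :=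
  (0 < orient A.1 A.2 B.1 ∧ 0 < orient A.1 A.2 B.2) ∨
  (orient A.1 A.2 B.1 < 0 ∧ orient A.1 A.2 B.2 < 0) ∨
  (orient A.1 A.2 B.1 = 0 ∧ orient A.1 A.2 B.2 ≠ 0 ∧ ∃ v, pos v = B.1) ∨
  (orient A.1 A.2 B.2 = 0 ∧ orient A.1 A.2 B.1 ≠ 0 ∧ ∃ v, pos v = B.2)

instance {n : ℕ} (pos : Fin n → ℤ × ℤ) (A B : (ℤ × ℤ) × (ℤ × ℤ)) :
    Decidable (OneSided pos A B) := by
  unfold OneSided; infer_instance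

/-- The orientation relative to `A` is affine along `B` and vanishes at points of `A`. Equal strict
signs at the ends of `B` leave no zero; a zero at exactly one end makes that end the only candidate,
and it is a vertex, which `hP` excludes. -/
theorem OneSided.disjoint {n : ℕ} {pos : Fin n → ℤ × ℤ} {A B : (ℤ × ℤ) × (ℤ × ℤ)}
    (h : OneSided pos A B) {P : ℝ × ℝ} (hP : ∀ v, P ≠ toPlane (pos v))
    (hA : OnPiece A P) (hB : OnPiece B P) : False := by
  have h0 := hA.orientReal_eq_zero
  obtain ⟨t, ⟨ht0, ht1⟩, rfl⟩ := hB
  rw [orientReal_seg, orientReal_toPlane, orientReal_toPlane] at h0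
  rcases h with ⟨h1, h2⟩ | ⟨h1, h2⟩ | ⟨h1, h2, v, hv⟩ | ⟨h1, h2, v, hv⟩
  · have h1' : (0 : ℝ) < orient A.1 A.2 B.1 := by exact_mod_cast h1
    have h2' : (0 : ℝ) < orient A.1 A.2 B.2 := by exact_mod_cast h2
    rcases ht0.eq_or_lt with rfl | ht
    · linarith
    · linarith [mul_pos ht h2', mul_nonneg (sub_nonneg.2 ht1) h1'.le]
  · have h1' : (orient A.1 A.2 B.1 : ℝ) < 0 := by exact_mod_cast h1
    have h2' : (orient A.1 A.2 B.2 : ℝ) < 0 := by exact_mod_cast h2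
    rcases ht0.eq_or_lt with rfl | ht
    · linarith
    · linarith [mul_neg_of_pos_of_neg ht h2',
        mul_nonpos_of_nonneg_of_nonpos (sub_nonneg.2 ht1) h1'.le]
  · have h2' : (orient A.1 A.2 B.2 : ℝ) ≠ 0 := by exact_mod_cast h2
    rw [h1] at h0
    have : t = 0 := by simpa [h2'] using h0
    subst this
    exact hP v (by rw [seg_zero, hv])
  · have h2' : (orient A.1 A.2 B.1 : ℝ) ≠ 0 := by exact_mod_cast h2
    rw [h1] at h0
    have : 1 - t = 0 := by simpa [h2'] using h0
    have : t = 1 := by linarith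
    subst this
    exact hP v (by rw [seg_one, hv])

theorem OnPiece.unique {A B : (ℤ × ℤ) × (ℤ × ℤ)}
    (h : orient A.1 A.2 B.1 ≠ orient A.1 A.2 B.2) {P Q : ℝ × ℝ}
    (hPA : OnPiece A P) (hPB : OnPiece B P) (hQA : OnPiece A Q) (hQB : OnPiece B Q) : P = Q := by
  have hP := hPA.orientReal_eq_zero
  have hQ := hQA.orientReal_eq_zero
  obtain ⟨t, -, rfl⟩ := hPB
  obtain ⟨u, -, rfl⟩ := hQB
  rw [orientReal_seg, orientReal_toPlane, orientReal_toPlane] at hP hQ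
  have h' : (orient A.1 A.2 B.1 : ℝ) - orient A.1 A.2 B.2 ≠ 0 := sub_ne_zero.2 (by exact_mod_cast h)
  have : t = u := mul_right_cancel₀ h' (by linarith)
  rw [this]

/-- An edge between two numbered vertices together with an optional bend of its drawing. -/
abbrev Route (n : ℕ) := Fin n × Fin n × Option (ℤ × ℤ)

/-- The segments of the drawing of a route. -/
def Route.pieces {n : ℕ} (pos : Fin n → ℤ × ℤ) (r : Route n) : List ((ℤ × ℤ) × (ℤ × ℤ)) :=
  OnePlanarReduction.pieces (pos r.1) (pos r.2.1) r.2.2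

/-- The graph whose edges are listed by `E`. -/
def routeGraph {n : ℕ} (E : List (Route n)) : SimpleGraph (Fin n) :=
  SimpleGraph.fromRel fun a b => ∃ r ∈ E, r.1 = a ∧ r.2.1 = b

instance {n : ℕ} (E : List (Route n)) : DecidableRel (routeGraph E).Adj := fun a b =>
  inferInstanceAs (Decidable (a ≠ b ∧
    ((∃ r ∈ E, r.1 = a ∧ r.2.1 = b) ∨ ∃ r ∈ E, r.1 = b ∧ r.2.1 = a)))

theorem mem_edgeSet_routeGraph {n : ℕ} {E : List (Route n)} (hE : ∀ r ∈ E, r.1 ≠ r.2.1)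
    (e : Sym2 (Fin n)) : e ∈ (routeGraph E).edgeSet ↔ ∃ r ∈ E, s(r.1, r.2.1) = e := by
  induction e with
  | _ a b =>
    simp only [routeGraph, SimpleGraph.mem_edgeSet, SimpleGraph.fromRel_adj, Sym2.eq_iff]
    constructor
    · rintro ⟨-, ⟨r, hr, h⟩ | ⟨r, hr, h⟩⟩
      exacts [⟨r, hr, Or.inl h⟩, ⟨r, hr, Or.inr h⟩]
    · rintro ⟨r, hr, ⟨rfl, rfl⟩ | ⟨rfl, rfl⟩⟩
      exacts [⟨hE r hr, Or.inl ⟨r, hr, rfl, rfl⟩⟩, ⟨(hE r hr).symm, Or.inr ⟨r, hr, rfl, rfl⟩⟩]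

/-- The triples of a segment of `r`, another route, and a segment of that route that are not
visibly disjoint. -/
def meetings {n : ℕ} (pos : Fin n → ℤ × ℤ) (E : List (Route n)) (r : Route n) :
    List (((ℤ × ℤ) × (ℤ × ℤ)) × Route n × ((ℤ × ℤ) × (ℤ × ℤ))) :=
  (r.pieces pos).flatMap fun A => (E.filter (· ≠ r)).flatMap fun r' =>
    ((r'.pieces pos).filter fun B => ¬ (OneSided pos A B ∨ OneSided pos B A)).map fun B => (A, r', B)

theorem eq_of_mem_of_length_le_one {α : Type*} {l : List α} (h : l.length ≤ 1) {a b : α}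
    (ha : a ∈ l) (hb : b ∈ l) : a = b := by
  match l, h with
  | [c], _ => rw [List.mem_singleton.1 ha, List.mem_singleton.1 hb]

theorem mem_meetings {n : ℕ} {pos : Fin n → ℤ × ℤ} {E : List (Route n)} {r r' : Route n}
    {A B : (ℤ × ℤ) × (ℤ × ℤ)} (hA : A ∈ r.pieces pos) (hr' : r' ∈ E) (hne : r' ≠ r)
    (hB : B ∈ r'.pieces pos) (h : ¬ (OneSided pos A B ∨ OneSided pos B A)) :
    (A, r', B) ∈ meetings pos E r := by
  simp only [meetings, List.mem_flatMap, List.mem_map, List.mem_filter]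
  exact ⟨A, hA, r', ⟨hr', by simpa using hne⟩, B, ⟨hB, by simpa using h⟩, rfl⟩

/-- A checkable condition for the polygonal drawing given by `pos` and `E` to be a drawing in which
every edge is crossed at most once. -/
def IsOnePlanarRouting {n : ℕ} (pos : Fin n → ℤ × ℤ) (E : List (Route n)) : Prop :=
  (∀ a b, pos a = pos b → a = b) ∧
  (∀ r ∈ E, r.1 ≠ r.2.1) ∧
  (∀ r ∈ E, ∀ m ∈ r.2.2, orient (pos r.1) m (pos r.2.1) ≠ 0) ∧
  (∀ r ∈ E, ∀ v, v ≠ r.1 → v ≠ r.2.1 → ∀ A ∈ r.pieces pos, orient A.1 A.2 (pos v) ≠ 0) ∧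
  ∀ r ∈ E, (meetings pos E r).length ≤ 1 ∧
    ∀ c ∈ meetings pos E r, orient c.1.1 c.1.2 c.2.2.1 ≠ orient c.1.1 c.1.2 c.2.2.2

instance {n : ℕ} (pos : Fin n → ℤ × ℤ) (E : List (Route n)) :
    Decidable (IsOnePlanarRouting pos E) := by
  unfold IsOnePlanarRouting; infer_instance

open Classical in
/-- The curves of a polygonal drawing. -/
noncomputable def routeCurve {n : ℕ} (pos : Fin n → ℤ × ℤ) (E : List (Route n))
    (e : Sym2 (Fin n)) : ℝ → ℝ × ℝ :=
  if h : ∃ r ∈ E, s(r.1, r.2.1) = e then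
    path (toPlane (pos h.choose.1)) (toPlane (pos h.choose.2.1)) (h.choose.2.2.map toPlane)
  else 0

theorem exists_routeCurve_eq {n : ℕ} (pos : Fin n → ℤ × ℤ) {E : List (Route n)}
    (hE : ∀ r ∈ E, r.1 ≠ r.2.1) {e : Sym2 (Fin n)} (he : e ∈ (routeGraph E).edgeSet) :
    ∃ r ∈ E, s(r.1, r.2.1) = e ∧ routeCurve pos E e =
      path (toPlane (pos r.1)) (toPlane (pos r.2.1)) (r.2.2.map toPlane) := by
  have h := (mem_edgeSet_routeGraph hE e).1 he
  exact ⟨h.choose, h.choose_spec.1, h.choose_spec.2, by rw [routeCurve, dif_pos h]⟩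

theorem IsOnePlanarRouting.isDrawing {n : ℕ} {pos : Fin n → ℤ × ℤ} {E : List (Route n)}
    (h : IsOnePlanarRouting pos E) :
    IsDrawing (routeGraph E) (fun v => toPlane (pos v)) (routeCurve pos E) := by
  obtain ⟨hpos, hE, hbend, hvert, -⟩ := h
  have hposne : ∀ a b, a ≠ b → toPlane (pos a) ≠ toPlane (pos b) := fun a b hab h =>
    hab (hpos _ _ (toPlane_injective h))
  have inj : ∀ e ∈ (routeGraph E).edgeSet, InjOn (routeCurve pos E e) (Icc 0 1) := by
    intro e he
    obtain ⟨r, hr, rfl, hc⟩ := exists_routeCurve_eq pos hE he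
    rw [hc]
    cases hm : r.2.2 with
    | none => exact injOn_path_none (hposne _ _ (hE r hr))
    | some m =>
      refine injOn_path_some ?_
      rw [orientReal_toPlane]
      exact_mod_cast hbend r hr m hm
  refine ⟨fun a b hab => hpos _ _ (toPlane_injective hab), ?_, inj, ?_, ?_⟩
  · intro e he
    obtain ⟨r, hr, rfl, hc⟩ := exists_routeCurve_eq pos hE he
    rw [hc]
    exact (continuous_path _ _ _).continuousOn
  · intro e he
    obtain ⟨r, hr, rfl, hc⟩ := exists_routeCurve_eq pos hE he
    rw [hc, path_zero, path_one, Sym2.map_mk]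
  · intro e he t ht v hv
    have hinj := inj e he
    obtain ⟨r, hr, rfl, hc⟩ := exists_routeCurve_eq pos hE he
    rw [hc] at hv hinj
    have ht' := Ioo_subset_Icc_self ht
    -- The edge's own ends are already taken at the parameters 0 and 1, so injectivity keeps them
    -- out of the interior; other vertices do not even lie on the lines through the pieces.
    by_cases h1 : v = r.1
    · subst h1
      exact ht.1.ne' (hinj ht' ⟨le_rfl, zero_le_one⟩ (by rw [hv, path_zero]))
    by_cases h2 : v = r.2.1
    · subst h2
      exact ht.2.ne (hinj ht' ⟨zero_le_one, le_rfl⟩ (by rw [hv, path_one]))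
    obtain ⟨A, hA, hP⟩ := exists_piece (pos r.1) (pos r.2.1) r.2.2 ht'
    have h0 := hP.orientReal_eq_zero
    rw [hv, orientReal_toPlane] at h0
    exact hvert r hr v h1 h2 A hA (by exact_mod_cast h0)

theorem IsOnePlanarRouting.isOnePlanar {n : ℕ} {pos : Fin n → ℤ × ℤ} {E : List (Route n)}
    (h : IsOnePlanarRouting pos E) : IsOnePlanar (routeGraph E) := by
  have hd := h.isDrawing
  obtain ⟨-, hE, -, -, hmeet⟩ := h
  refine ⟨_, _, hd, ?_⟩
  intro e he
  obtain ⟨r, hr, hre, hc⟩ := exists_routeCurve_eq pos hE he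
  have key : ∀ c ∈ crossings (routeGraph E) (routeCurve pos E) e, ∃ A r' B,
      (A, r', B) ∈ meetings pos E r ∧ c.1 = s(r'.1, r'.2.1) ∧ OnPiece A c.2 ∧ OnPiece B c.2 := by
    rintro ⟨f, P⟩ ⟨hf, hfe, ⟨t, ht, htP⟩, u, hu, huP⟩
    dsimp only at hf hfe htP huP ⊢
    obtain ⟨r', hr', hre', hc'⟩ := exists_routeCurve_eq pos hE hf
    have hPv : ∀ v, P ≠ toPlane (pos v) := fun v => htP ▸ hd.interior e he t ht v
    rw [hc] at htP
    rw [hc'] at huP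
    obtain ⟨A, hA, hAP⟩ := exists_piece (pos r.1) (pos r.2.1) r.2.2 (Ioo_subset_Icc_self ht)
    obtain ⟨B, hB, hBP⟩ := exists_piece (pos r'.1) (pos r'.2.1) r'.2.2 (Ioo_subset_Icc_self hu)
    rw [htP] at hAP
    rw [huP] at hBP
    refine ⟨A, r', B, mem_meetings hA hr' ?_ hB ?_, hre'.symm, hAP, hBP⟩
    · rintro rfl
      exact hfe (hre'.symm.trans hre)
    · rintro (h | h)
      exacts [h.disjoint hPv hAP hBP, h.disjoint hPv hBP hAP]
  intro c hc d hd'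
  obtain ⟨A, r', B, hm, h1, h2, h3⟩ := key c hc
  obtain ⟨A', r'', B', hm', h1', h2', h3'⟩ := key d hd'
  -- The only possible meeting fixes both the crossing edge and the two segments; the segments are
  -- not parallel, so the point is determined as well.
  have heq := eq_of_mem_of_length_le_one (hmeet r hr).1 hm hm'
  simp only [Prod.mk.injEq] at heq
  obtain ⟨rfl, rfl, rfl⟩ := heq
  exact Prod.ext (h1.trans h1'.symm) (OnPiece.unique ((hmeet r hr).2 _ hm) h2 h3 h2' h3')

theorem ncard_edgeSet_routeGraph {n : ℕ} {E : List (Route n)} (hE : ∀ r ∈ E, r.1 ≠ r.2.1)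
    (hnd : (E.map fun r => s(r.1, r.2.1)).Nodup) : (routeGraph E).edgeSet.ncard = E.length := by
  have : (routeGraph E).edgeSet = ((E.map fun r => s(r.1, r.2.1)).toFinset : Set _) := by
    ext e
    simp [mem_edgeSet_routeGraph hE]
  rw [this, Set.ncard_coe_finset, List.toFinset_card_of_nodup hnd, List.length_map]


/-! ### Connectivity by bit masks -/

/-- The union of the masks `M[v]` over the bits `v` of `r`. -/
def maskUnion : List ℕ → ℕ → ℕ
  | [], _ => 0
  | m :: M, r => (if r.testBit 0 then m else 0) ||| maskUnion M (r >>> 1)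

theorem exists_of_testBit_maskUnion {M : List ℕ} {r w : ℕ} (h : (maskUnion M r).testBit w) :
    ∃ v, r.testBit v ∧ (M.getD v 0).testBit w := by
  induction M generalizing r with
  | nil => simp [maskUnion] at h
  | cons m M ih =>
    simp only [maskUnion, Nat.testBit_or, Bool.or_eq_true] at h
    rcases h with h | h
    · split_ifs at h with h0
      · exact ⟨0, h0, by simpa using h⟩
      · simp at h
    · obtain ⟨v, hv, hw⟩ := ih h
      refine ⟨v + 1, ?_, by simpa using hw⟩
      rwa [Nat.testBit_shiftRight, add_comm] at hv

/-- The vertices of `B` that are reached from `r` by at most `k` steps in `B`, where `M` lists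
the neighbourhoods. -/
def maskReach (M : List ℕ) (B : ℕ) : ℕ → ℕ → ℕ
  | 0, r => r
  | k + 1, r => maskReach M B k (r ||| (maskUnion M r &&& B))

/-- Only soundness of the search is needed: whatever it marks is really reachable. That it marks all
of `B` is part of the computed test. -/
theorem maskReach_induction {M : List ℕ} {B : ℕ} {Q : ℕ → Prop}
    (hstep : ∀ v w, Q v → (M.getD v 0).testBit w → B.testBit w → Q w) (k : ℕ) {r : ℕ}
    (hr : ∀ v, r.testBit v → Q v) : ∀ v, (maskReach M B k r).testBit v → Q v := by
  induction k generalizing r with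
  | zero => exact hr
  | succ k ih =>
    refine ih fun v hv => ?_
    simp only [Nat.testBit_or, Nat.testBit_and, Bool.or_eq_true, Bool.and_eq_true] at hv
    rcases hv with hv | ⟨hv, hB⟩
    · exact hr v hv
    · obtain ⟨u, hu, huv⟩ := exists_of_testBit_maskUnion hv
      exact hstep u v (hr u hu) huv hB

/-- All vertices of the mask `B` are reached within `B` by at most four steps from the last one. -/
def maskConnected (M : List ℕ) (B : ℕ) : Bool :=
  -- The first test rejects `B = 0`, for which `log2` takes the default value 0.
  B.testBit B.log2 && maskReach M B 4 (1 <<< B.log2) == B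

/-- The test `p` holds for all masks that arise from `A` by deleting at most `k` of the bits below
`i`. -/
def forallErase (p : ℕ → Bool) : ℕ → ℕ → ℕ → Bool
  | 0, _, A => p A
  | _ + 1, 0, A => p A
  | k + 1, i + 1, A => forallErase p (k + 1) i A && forallErase p k i (A ^^^ (A &&& 1 <<< i))

theorem forallErase_spec {p : ℕ → Bool} {i k A : ℕ} (h : forallErase p k i A) (T : Finset ℕ)
    (hT : ∀ t ∈ T, t < i) (hk : T.card ≤ k) {B : ℕ}
    (hB : ∀ v, B.testBit v = (A.testBit v && v ∉ T)) : p B := by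
  have base : ∀ (A : ℕ) (T : Finset ℕ), T = ∅ → (∀ v, B.testBit v = (A.testBit v && v ∉ T)) → p A → p B := by
    rintro A _ rfl hB hA
    rwa [show B = A from Nat.eq_of_testBit_eq fun v => by simp [hB v]]
  induction i generalizing k A T with
  | zero =>
    have hT0 : T = ∅ := Finset.eq_empty_of_forall_notMem fun t ht => (hT t ht).not_ge t.zero_le
    cases k <;> exact base A T hT0 hB h
  | succ i ih =>
    cases k with
    | zero => exact base A T (Finset.card_eq_zero.1 (Nat.le_zero.1 hk)) hB h
    | succ k =>
      simp only [forallErase, Bool.and_eq_true] at h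
      have lt_of_ne : ∀ t ∈ T, t ≠ i → t < i := fun t ht hne => by have := hT t ht; omega
      by_cases hi : i ∈ T
      · refine ih h.2 (T.erase i) (fun t ht => ?_) ?_ fun v => ?_
        · exact lt_of_ne t (Finset.mem_of_mem_erase ht) (Finset.ne_of_mem_erase ht)
        · rw [Finset.card_erase_of_mem hi]; omega
        · rw [hB, Nat.testBit_xor, Nat.testBit_and, Nat.one_shiftLeft, Nat.testBit_two_pow]
          by_cases hv : i = v
          · subst hv; simp [hi]
          · simp [hv, Ne.symm hv]
      · refine ih h.1 T (fun t ht => lt_of_ne t ht fun e => hi (e ▸ ht)) hk hB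

/-- The masks need only list edges of `G`: omitting some could only make the test fail. -/
theorem isVertexConnected_of_mask {n k : ℕ} {G : SimpleGraph (Fin n)} {M : List ℕ}
    (hn : k + 1 < n) (hM : ∀ v w : Fin n, (M.getD v 0).testBit w → G.Adj v w)
    (h : forallErase (maskConnected M) k n (2 ^ n - 1)) :
    IsVertexConnected (k + 1) ⟨Fin n, inferInstance, G⟩ := by
  classical
  refine ⟨by simpa using hn, fun S hS => ?_⟩
  change Set (Fin n) at S
  change (G.induce Sᶜ).Connected
  set B : ℕ := Nat.ofBits fun i : Fin n => decide (i ∉ S) with hBdef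
  have hBlt : ∀ v : Fin n, B.testBit v ↔ v ∉ S := fun v => by
    rw [hBdef, Nat.testBit_ofBits_lt _ _ v.2]; simp
  have hBge : ∀ v : ℕ, B.testBit v → v < n := fun v hv => by
    by_contra hle
    rw [hBdef, Nat.testBit_ofBits_ge _ _ (not_lt.1 hle)] at hv
    exact Bool.false_ne_true hv
  have hB : maskConnected M B := by
    refine forallErase_spec h (S.toFinset.map Fin.valEmbedding) ?_ ?_ fun v => ?_
    · intro t ht
      obtain ⟨v, -, rfl⟩ := Finset.mem_map.1 ht
      exact v.2
    · rw [Finset.card_map, ← Set.ncard_eq_toFinset_card']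
      exact Nat.lt_succ_iff.1 hS
    · rw [Nat.testBit_two_pow_sub_one, Bool.eq_iff_iff]
      constructor
      · intro hv
        have hvn := hBge v hv
        have := (hBlt ⟨v, hvn⟩).1 hv
        simp only [hvn, decide_true, Bool.true_and, decide_eq_true_eq, Finset.mem_map]
        rintro ⟨u, hu, rfl⟩
        exact this (Set.mem_toFinset.1 hu)
      · intro hv
        simp only [Bool.and_eq_true, decide_eq_true_eq] at hv
        refine (hBlt ⟨v, hv.1⟩).2 fun hS => hv.2 (Finset.mem_map.2 ⟨⟨v, hv.1⟩, ?_, rfl⟩)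
        exact Set.mem_toFinset.2 hS
  simp only [maskConnected, Bool.and_eq_true, beq_iff_eq] at hB
  obtain ⟨hroot, hreach⟩ := hB
  have hrn := hBge _ hroot
  have hrS := (hBlt ⟨_, hrn⟩).1 hroot
  refine SimpleGraph.connected_iff_exists_forall_reachable _ |>.2 ⟨⟨⟨B.log2, hrn⟩, hrS⟩, ?_⟩
  have key := maskReach_induction (M := M) (B := B)
    (Q := fun v => ∃ hv : v < n, ∃ hS : (⟨v, hv⟩ : Fin n) ∈ Sᶜ,
      (G.induce Sᶜ).Reachable ⟨⟨B.log2, hrn⟩, hrS⟩ ⟨⟨v, hv⟩, hS⟩) ?_ 4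
    (r := 1 <<< B.log2) ?_
  · rintro ⟨v, hv⟩
    obtain ⟨_, _, h⟩ := key v (by rw [hreach]; exact (hBlt v).2 hv)
    exact h
  · rintro v w ⟨hv, hvS, hvr⟩ hvw hw
    have hwn := hBge _ hw
    exact ⟨hwn, (hBlt ⟨w, hwn⟩).1 hw,
      hvr.trans (SimpleGraph.Adj.reachable (hM ⟨v, hv⟩ ⟨w, hwn⟩ hvw))⟩
  · intro v hv
    rw [Nat.one_shiftLeft, Nat.testBit_two_pow, decide_eq_true_eq] at hv
    subst hv
    exact ⟨hrn, hrS, .refl _⟩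

/-! ### Invariance under isomorphisms -/

theorem IsOnePlanar.of_iso {V W : Type} {G : SimpleGraph V} {H : SimpleGraph W} (φ : H ≃g G)
    (h : IsOnePlanar G) : IsOnePlanar H := by
  obtain ⟨pos, curve, hd, hc⟩ := h
  have hφ : Function.Injective (Sym2.map φ) := Sym2.map.injective φ.injective
  have hmem : ∀ e ∈ H.edgeSet, Sym2.map φ e ∈ G.edgeSet := fun e he => by
    induction e with
    | _ a b => exact φ.map_adj_iff.2 he
  refine ⟨pos ∘ φ, fun e => curve (Sym2.map φ e), ⟨?_, ?_, ?_, ?_, ?_⟩, ?_⟩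
  · exact hd.pos_injective.comp φ.injective
  · exact fun e he => hd.continuousOn _ (hmem e he)
  · exact fun e he => hd.injOn _ (hmem e he)
  · intro e he
    rw [hd.ends _ (hmem e he), Sym2.map_map]
  · exact fun e he t ht v => hd.interior _ (hmem e he) t ht (φ v)
  · rintro e he ⟨f, P⟩ ⟨h1, h2, h3, h4⟩ ⟨g, Q⟩ ⟨h1', h2', h3', h4'⟩
    have := hc _ (hmem e he) (show (Sym2.map φ f, P) ∈ _ from ⟨hmem f h1, fun h => h2 (hφ h), h3, h4⟩)
      (show (Sym2.map φ g, Q) ∈ _ from ⟨hmem g h1', fun h => h2' (hφ h), h3', h4'⟩)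
    simp only [Prod.mk.injEq] at this ⊢
    exact ⟨hφ this.1, this.2⟩

theorem IsVertexConnected.of_iso {k : ℕ} {G H : FinGraph} (φ : H.graph ≃g G.graph)
    (h : IsVertexConnected k G) : IsVertexConnected k H := by
  refine ⟨by rw [Nat.card_congr φ.toEquiv]; exact h.1, fun S hS => ?_⟩
  have hS' := h.2 (φ '' S) (by rwa [Set.ncard_image_of_injective _ φ.injective])
  have ψ : H.graph.induce Sᶜ ≃g G.graph.induce (φ '' S)ᶜ :=
    { toEquiv := (φ.toEquiv.image Sᶜ).trans
        (Equiv.setCongr (Set.image_compl_eq φ.bijective))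
      map_rel_iff' := φ.map_adj_iff }
  exact ψ.connected_iff.2 hS'

theorem IsFiveConnectedOptimal.of_iso {G H : FinGraph} (φ : H.graph ≃g G.graph)
    (h : IsFiveConnectedOptimal G) : IsFiveConnectedOptimal H := by
  obtain ⟨⟨h1, h2, h3⟩, h4⟩ := h
  refine ⟨⟨h1.of_iso φ, ?_, ?_⟩, h4.of_iso φ⟩
  · rwa [Nat.card_congr φ.toEquiv]
  · have := Nat.card_congr φ.mapEdgeSet
    rw [Nat.card_congr φ.toEquiv, ← h3, ← Nat.card_coe_set_eq, ← Nat.card_coe_set_eq, this]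

/-- The numbered graph with edge list `E`. -/
def routeFinGraph {n : ℕ} (E : List (Route n)) : FinGraph := ⟨Fin n, inferInstance, routeGraph E⟩

theorem isFiveConnectedOptimal_routeFinGraph {n : ℕ} {E : List (Route n)}
    (pos : Fin n → ℤ × ℤ) (M : List ℕ) (hn : 5 < n) (hlen : E.length + 8 = 4 * n)
    (hnd : (E.map fun r => s(r.1, r.2.1)).Nodup) (hE : IsOnePlanarRouting pos E)
    (hM : ∀ v w : Fin n, (M.getD v 0).testBit w → (routeGraph E).Adj v w)
    (hconn : forallErase (maskConnected M) 4 n (2 ^ n - 1)) :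
    IsFiveConnectedOptimal (routeFinGraph E) := by
  refine ⟨⟨hE.isOnePlanar, ?_, ?_⟩, isVertexConnected_of_mask hn hM hconn⟩
  · simp only [routeFinGraph, Nat.card_eq_fintype_card, Fintype.card_fin]; omega
  · simp only [routeFinGraph, Nat.card_eq_fintype_card, Fintype.card_fin]
    rw [ncard_edgeSet_routeGraph hE.2.1 hnd, hlen]

/-! ### Reduction steps -/

/-- Labelling the reduced graph by an injection `f` with image the complement of `x` avoids the
subtype in `srResult`, so that for concrete graphs every hypothesis can be decided. -/
theorem srStep_of_map {V W : Type} [Finite V] [Finite W] {G : SimpleGraph V} {H : SimpleGraph W}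
    (x : V) (y : Fin 6 → V) (f : W → V) (hcs : IsCrossedStar G x y) (hf : SRFeasible G y)
    (hinj : ∀ a b, f a = f b → a = b) (hrange : ∀ v, v ≠ x ↔ ∃ w, f w = v)
    (hadj : ∀ a b, ((G \ SimpleGraph.edge (y 2) (y 4)) ⊔ SimpleGraph.edge (y 3) (y 0) ⊔
      SimpleGraph.edge (y 3) (y 1) ⊔ SimpleGraph.edge (y 3) (y 5)).Adj (f a) (f b) ↔ H.Adj a b) :
    SRStep ⟨V, inferInstance, G⟩ ⟨W, inferInstance, H⟩ := by
  refine ⟨x, y, hcs, hf, ⟨⟨Equiv.ofBijective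
    (fun w => ⟨f w, (hrange _).2 ⟨w, rfl⟩⟩) ⟨fun a b h => ?_, fun v => ?_⟩, ?_⟩⟩⟩
  · exact hinj a b (congrArg Subtype.val h)
  · obtain ⟨w, hw⟩ := (hrange v).1 v.2
    exact ⟨w, Subtype.ext hw⟩
  · intro a b
    exact hadj a b

instance decidableRelEdgeAdj {V : Type} [DecidableEq V] (s t : V) :
    DecidableRel (SimpleGraph.edge s t).Adj := fun _ _ =>
  decidable_of_iff _ (SimpleGraph.edge_adj ..).symm

theorem isCrossedStar_iff {V : Type} {G : SimpleGraph V} {x : V} {y : Fin 6 → V} :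
    IsCrossedStar G x y ↔ (∀ i j, y i = y j → i = j) ∧ (∀ v, G.Adj x v ↔ ∃ i, y i = v) ∧
      (∀ i, G.Adj (y i) (y (i + 1))) ∧ G.Adj (y 0) (y 2) ∧ G.Adj (y 2) (y 4) ∧ G.Adj (y 4) (y 0) :=
  ⟨fun h => ⟨h.injective, fun v => Set.ext_iff.1 h.neighbors v, h.hexagon, h.triangle⟩,
    fun ⟨h1, h2, h3, h4⟩ => ⟨h1, Set.ext h2, h3, h4⟩⟩

/-! ### Extended wheel graphs -/

instance (k : ℕ) : DecidableRel (extendedWheelGraph k).Adj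
  | .inl i, .inl j => inferInstanceAs (Decidable ((Sum.inl i : Fin (2 * k) ⊕ Bool) ≠ Sum.inl j ∧
      ((j.val = (i.val + 1) % (2 * k) ∨ j.val = (i.val + 2) % (2 * k)) ∨
        (i.val = (j.val + 1) % (2 * k) ∨ i.val = (j.val + 2) % (2 * k)))))
  | .inl i, .inr j => inferInstanceAs (Decidable ((Sum.inl i : Fin (2 * k) ⊕ Bool) ≠ Sum.inr j ∧
      (True ∨ False)))
  | .inr i, .inl j => inferInstanceAs (Decidable ((Sum.inr i : Fin (2 * k) ⊕ Bool) ≠ Sum.inl j ∧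
      (False ∨ True)))
  | .inr i, .inr j => inferInstanceAs (Decidable ((Sum.inr i : Fin (2 * k) ⊕ Bool) ≠ Sum.inr j ∧
      (False ∨ False)))

theorem XW_iso_iff {k l : ℕ} : (XW k).Iso (XW l) ↔ k = l := by
  refine ⟨fun ⟨φ⟩ => ?_, ?_⟩
  · have := Nat.card_congr φ.toEquiv
    simp only [XW, Nat.card_eq_fintype_card, Fintype.card_sum, Fintype.card_fin,
      Fintype.card_bool] at this
    omega
  · rintro rfl
    exact ⟨SimpleGraph.Iso.refl⟩

/-- Feasibility makes `y 0`, `y 1`, `y 5` three neighbours of `x` that are not adjacent to its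
neighbour `y 3`. In $XW_8$ and $XW_{10}$ at most two can occur; the worst case is a rim vertex at
distance two from `x`. -/
theorem not_srStep {V : Type} [Fintype V] [DecidableEq V] [Finite V] {G : SimpleGraph V}
    [DecidableRel G.Adj] (hG : ∀ x, G.degree x ≤ 6 → ∀ u, G.Adj x u →
      (Finset.univ.filter fun z => G.Adj x z ∧ z ≠ u ∧ ¬ G.Adj u z).card ≤ 2) (H : FinGraph) :
    ¬ SRStep ⟨V, inferInstance, G⟩ H := by
  rintro ⟨x, y, hcs, ⟨h1, h5, h0⟩, -⟩
  change V at x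
  change Fin 6 → V at y
  have hy : ∀ i, G.Adj x (y i) := fun i => by
    have : y i ∈ range y := ⟨i, rfl⟩
    rwa [← hcs.neighbors] at this
  have hsub : ({y 0, y 1, y 5} : Finset V) ⊆
      Finset.univ.filter fun z => G.Adj x z ∧ z ≠ y 3 ∧ ¬ G.Adj (y 3) z := by
    intro z hz
    simp only [Finset.mem_insert, Finset.mem_singleton] at hz
    simp only [Finset.mem_filter, Finset.mem_univ, true_and]
    rcases hz with rfl | rfl | rfl
    · exact ⟨hy _, hcs.injective.ne (by decide), fun h => h0 h.symm⟩
    · exact ⟨hy _, hcs.injective.ne (by decide), fun h => h1 h.symm⟩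
    · exact ⟨hy _, hcs.injective.ne (by decide), fun h => h5 h.symm⟩
  have hcard : ({y 0, y 1, y 5} : Finset V).card = 3 :=
    Finset.card_eq_three.2 ⟨_, _, _, hcs.injective.ne (by decide), hcs.injective.ne (by decide),
      hcs.injective.ne (by decide), rfl⟩
  have hdeg : G.degree x ≤ 6 := by
    have hsub : G.neighborFinset x ⊆ Finset.univ.image y := fun z hz => by
      have hz' : z ∈ G.neighborSet x := by simpa using hz
      rw [hcs.neighbors] at hz'
      simpa using hz'
    exact (Finset.card_le_card hsub).trans Finset.card_image_le
  have := (Finset.card_le_card hsub).trans (hG x hdeg (y 3) (hy 3))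
  omega

/-- The inner cycle of a crossed cube is a $K_4$ on vertices of degree at most six. In $XW_8$ and
$XW_{10}$ the poles have degree 8 and 10, and the rim with its distance-two edges contains no $K_4$.
-/
theorem not_crStep {V : Type} [Fintype V] [DecidableEq V] [Finite V] {G : SimpleGraph V}
    [DecidableRel G.Adj] (hG : ∀ a, G.degree a ≤ 6 → ∀ b, G.degree b ≤ 6 → G.Adj a b →
      ∀ c, G.degree c ≤ 6 → G.Adj a c → G.Adj b c →
      ∀ d, G.degree d ≤ 6 → G.Adj a d → G.Adj b d → ¬ G.Adj c d) (H : FinGraph) :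
    ¬ CRStep ⟨V, inferInstance, G⟩ H := by
  rintro ⟨x, v, hcc, -, -⟩
  change Fin 4 → V at x
  change Fin 4 → V at v
  have hdeg : ∀ i, G.degree (x i) ≤ 6 := fun i => by
    have hsub : G.neighborFinset (x i) ⊆
        {x (i + 1), x (i + 2), x (i + 3)} ∪ {v (i - 1), v i, v (i + 1)} := by
      intro z hz
      have hz' : z ∈ G.neighborSet (x i) := by simpa using hz
      rw [hcc.neighbors i] at hz'
      simp only [Set.mem_union, Set.mem_insert_iff, Set.mem_singleton_iff] at hz'
      simpa only [Finset.mem_union, Finset.mem_insert, Finset.mem_singleton] using hz'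
    refine (Finset.card_le_card hsub).trans ((Finset.card_union_le _ _).trans ?_)
    exact add_le_add Finset.card_le_three Finset.card_le_three
  have hadj : ∀ i j, j ≠ 0 → G.Adj (x i) (x (i + j)) := fun i j hj => by
    have : x (i + j) ∈ G.neighborSet (x i) := by
      rw [hcc.neighbors i]
      left
      fin_cases j <;> simp at hj ⊢
    exact this
  exact hG _ (hdeg 0) _ (hdeg 1) (hadj 0 1 (by decide)) _ (hdeg 2) (hadj 0 2 (by decide))
    (hadj 1 1 (by decide)) _ (hdeg 3) (hadj 0 3 (by decide)) (hadj 1 2 (by decide))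
    (hadj 2 1 (by decide))

theorem isIrreducible_XW_four : IsIrreducible SRCRStep (XW 4) := by
  rintro H (h | h)
  · exact not_srStep (G := extendedWheelGraph 4) (by decide +kernel) H h
  · exact not_crStep (G := extendedWheelGraph 4) (by decide +kernel) H h

theorem isIrreducible_XW_five : IsIrreducible SRCRStep (XW 5) := by
  rintro H (h | h)
  · exact not_srStep (G := extendedWheelGraph 5) (by decide +kernel) H h
  · exact not_crStep (G := extendedWheelGraph 5) (by decide +kernel) H h


/-! ### The graphs of the counterexample -/

/-- The edges of `XW_8`, with the bends of a drawing. -/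
def wheelTenEdges : List (Route 10) :=
   -- All vertices lie in the quadrilateral 0, 7, 6, 8. Only its diagonals are bent: they run around
   -- the outside and cross there.
   [(0, 1, none), (0, 2, none), (0, 6, some (11, 30)), (0, 7, none), (0, 8, none), (0, 9, none),
    (1, 2, none), (1, 3, none), (1, 7, none), (1, 8, none), (1, 9, none), (2, 3, none),
    (2, 4, none), (2, 8, none), (2, 9, none), (3, 4, none), (3, 5, none), (3, 8, none),
    (3, 9, none), (4, 5, none), (4, 6, none), (4, 8, none), (4, 9, none), (5, 6, none),
    (5, 7, none), (5, 8, none), (5, 9, none), (6, 7, none), (6, 8, none), (6, 9, none),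
    (7, 8, some (30, 1)), (7, 9, none)]

/-- Positions of the vertices of `XW_8`. -/
def wheelTenPos (i : Fin 10) : ℤ × ℤ :=
  [(-10, 0), (-3, 2), (-1, 4), (1, 3), (2, 5), (5, 2), (10, 0), (0, -10), (0, 10), (1, -1)].getD i (0, 0)

theorem isFiveConnectedOptimal_wheelTen : IsFiveConnectedOptimal (routeFinGraph wheelTenEdges) :=
  isFiveConnectedOptimal_routeFinGraph wheelTenPos
    -- Bit `w` of entry `v` stands for the edge `vw`; 255 is the whole rim, seen from the poles 8
    -- and 9.
    [966, 909, 795, 822, 876, 984, 945, 867, 255, 255]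
    (by decide) (by decide +kernel) (by decide +kernel) (by decide +kernel) (by decide +kernel)
    (by decide +kernel)

/-- The edges of an expansion of `XW_8` with eleven vertices, with the bends of a drawing. -/
def splitElevenEdges : List (Route 11) :=
   [(0, 1, none), (0, 2, none), (0, 6, none), (0, 7, none), (0, 9, none), (0, 10, none),
    (1, 2, none), (1, 3, none), (1, 7, none), (1, 9, none), (1, 10, none), (2, 3, none),
    (2, 4, none), (2, 6, none), (2, 8, none), (2, 9, none), (2, 10, none), (3, 4, none),
    (3, 5, none), (3, 8, none), (3, 9, none), (4, 5, none), (4, 6, some (36, 1)), (4, 8, none),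
    (4, 9, none), (5, 6, none), (5, 7, none), (5, 8, some (13, 36)), (5, 9, none), (6, 7, none),
    (6, 8, none), (6, 9, none), (6, 10, none), (7, 9, none), (7, 10, none), (8, 10, none)]

/-- Positions of the vertices of an expansion of `XW_8` with eleven vertices. -/
def splitElevenPos (i : Fin 11) : ℤ × ℤ :=
  [(-3, 4), (-4, 2), (-7, 1), (-2, -3), (0, -12), (12, 0), (0, 12), (-1, 6), (-12, 0), (1, 1),
    (-3, 5)].getD i (0, 0)

theorem isFiveConnectedOptimal_splitEleven : IsFiveConnectedOptimal (routeFinGraph splitElevenEdges) :=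
  isFiveConnectedOptimal_routeFinGraph splitElevenPos
    [1734, 1677, 1883, 822, 876, 984, 1973, 1635, 1148, 255, 455]
    (by decide) (by decide +kernel) (by decide +kernel) (by decide +kernel) (by decide +kernel)
    (by decide +kernel)

/-- The edges of an expansion of `XW_8` with twelve vertices, with the bends of a drawing. -/
def splitTwelveEdges : List (Route 12) :=
   [(0, 1, none), (0, 2, none), (0, 6, none), (0, 7, none), (0, 9, none), (0, 10, none),
    (1, 2, none), (1, 3, none), (1, 5, none), (1, 7, none), (1, 9, none), (1, 10, none),
    (1, 11, none), (2, 3, none), (2, 4, none), (2, 6, some (30, 1)), (2, 8, none), (2, 10, none),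
    (2, 11, none), (3, 4, none), (3, 5, none), (3, 8, none), (3, 11, none), (4, 5, none),
    (4, 6, none), (4, 8, none), (4, 11, none), (5, 6, none), (5, 7, none), (5, 8, none),
    (5, 9, none), (5, 11, none), (6, 7, none), (6, 8, none), (6, 9, none), (6, 10, none),
    (7, 9, none), (7, 10, none), (8, 10, some (11, 30)), (9, 11, none)]

/-- Positions of the vertices of an expansion of `XW_8` with twelve vertices. -/
def splitTwelvePos (i : Fin 12) : ℤ × ℤ :=
  [(-4, -1), (-1, 2), (0, 10), (2, 3), (4, 1), (1, -2), (0, -10), (-2, -4), (10, 0), (-1, -1),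
    (-10, 0), (1, 1)].getD i (0, 0)

theorem isFiveConnectedOptimal_splitTwelve : IsFiveConnectedOptimal (routeFinGraph splitTwelveEdges) :=
  isFiveConnectedOptimal_routeFinGraph splitTwelvePos
    [1734, 3757, 3419, 2358, 2412, 3034, 1973, 1635, 1148, 2275, 455, 574]
    (by decide) (by decide +kernel) (by decide +kernel) (by decide +kernel) (by decide +kernel)
    (by decide +kernel)

/-- The edges of the common ancestor of `XW_8` and `XW_10`, with the bends of a drawing. -/
def splitThirteenEdges : List (Route 13) :=
   [(0, 1, none), (0, 2, none), (0, 6, none), (0, 7, none), (0, 9, none), (0, 10, none),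
    (1, 2, none), (1, 3, none), (1, 5, some (42, 1)), (1, 7, none), (1, 8, none), (1, 9, none),
    (1, 10, none), (1, 11, none), (1, 12, none), (2, 6, none), (2, 8, none), (2, 10, none),
    (2, 12, none), (3, 4, none), (3, 5, none), (3, 8, none), (3, 11, none), (3, 12, none),
    (4, 5, none), (4, 6, none), (4, 8, none), (4, 11, none), (4, 12, none), (5, 6, none),
    (5, 7, none), (5, 8, none), (5, 9, none), (5, 11, none), (6, 7, none), (6, 8, none),
    (6, 9, none), (6, 10, none), (7, 9, none), (7, 10, none), (8, 10, none), (8, 12, none),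
    (9, 11, some (15, 42)), (11, 12, none)]

/-- Positions of the vertices of the common ancestor of `XW_8` and `XW_10`. -/
def splitThirteenPos (i : Fin 13) : ℤ × ℤ :=
  [(5, -5), (0, -14), (1, -9), (-4, 2), (-1, 6), (0, 14), (3, -1), (9, -2), (1, -3), (14, 0),
    (3, -3), (-14, 0), (-1, -9)].getD i (0, 0)

theorem isFiveConnectedOptimal_splitThirteen : IsFiveConnectedOptimal (routeFinGraph splitThirteenEdges) :=
  isFiveConnectedOptimal_routeFinGraph splitThirteenPos
    [1734, 8109, 5443, 6450, 6504, 3034, 1973, 1635, 5246, 2275, 455, 4666, 2334]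
    (by decide) (by decide +kernel) (by decide +kernel) (by decide +kernel) (by decide +kernel)
    (by decide +kernel)

/-- The edges of `XW_10`, with the bends of a drawing. -/
def wheelTwelveEdges : List (Route 12) :=
   [(0, 1, none), (0, 2, none), (0, 8, none), (0, 9, none), (0, 10, none), (0, 11, none),
    (1, 2, none), (1, 3, none), (1, 9, none), (1, 10, none), (1, 11, none), (2, 3, none),
    (2, 4, none), (2, 10, none), (2, 11, none), (3, 4, none), (3, 5, none), (3, 10, none),
    (3, 11, none), (4, 5, none), (4, 6, some (17, 48)), (4, 10, none), (4, 11, none),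
    (5, 6, none), (5, 7, none), (5, 10, some (48, 1)), (5, 11, none), (6, 7, none), (6, 8, none),
    (6, 10, none), (6, 11, none), (7, 8, none), (7, 9, none), (7, 10, none), (7, 11, none),
    (8, 9, none), (8, 10, none), (8, 11, none), (9, 10, none), (9, 11, none)]

/-- Positions of the vertices of `XW_10`. -/
def wheelTwelvePos (i : Fin 12) : ℤ × ℤ :=
  [(-1, -10), (-1, -7), (1, -9), (5, -4), (16, 0), (0, 16), (-16, 0), (-7, -2), (-3, -9),
    (-2, -7), (0, -16), (-3, -2)].getD i (0, 0)

theorem isFiveConnectedOptimal_wheelTwelve : IsFiveConnectedOptimal (routeFinGraph wheelTwelveEdges) :=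
  isFiveConnectedOptimal_routeFinGraph wheelTwelvePos
    [3846, 3597, 3099, 3126, 3180, 3288, 3504, 3936, 3777, 3459, 1023, 1023]
    (by decide) (by decide +kernel) (by decide +kernel) (by decide +kernel) (by decide +kernel)
    (by decide +kernel)

/-- A bijection that preserves and reflects adjacency is an isomorphism. -/
noncomputable def isoOfMap {V W : Type} {G : SimpleGraph V} {H : SimpleGraph W} (f : W → V)
    (hinj : ∀ a b, f a = f b → a = b) (hsurj : ∀ v, ∃ w, f w = v)
    (hadj : ∀ a b, G.Adj (f a) (f b) ↔ H.Adj a b) : H ≃g G where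
  toEquiv := Equiv.ofBijective f ⟨fun a b => hinj a b, hsurj⟩
  map_rel_iff' := hadj _ _

/-- The numbering of the vertices of `XW_{8}`. -/
def wheelTenIndex : Fin (2 * 4) ⊕ Bool → Fin 10
  | .inl i => ⟨i, by omega⟩
  | .inr false => 8
  | .inr true => 9

theorem isFiveConnectedOptimal_XW_four : IsFiveConnectedOptimal (XW 4) :=
  isFiveConnectedOptimal_wheelTen.of_iso (G := routeFinGraph wheelTenEdges) (H := XW 4)
    (isoOfMap (G := routeGraph wheelTenEdges) (H := extendedWheelGraph 4) wheelTenIndex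
      (by decide +kernel) (by decide +kernel) (by decide +kernel))

/-- The numbering of the vertices of `XW_{10}`. -/
def wheelTwelveIndex : Fin (2 * 5) ⊕ Bool → Fin 12
  | .inl i => ⟨i, by omega⟩
  | .inr false => 10
  | .inr true => 11

theorem isFiveConnectedOptimal_XW_five : IsFiveConnectedOptimal (XW 5) :=
  isFiveConnectedOptimal_wheelTwelve.of_iso (G := routeFinGraph wheelTwelveEdges) (H := XW 5)
    (isoOfMap (G := routeGraph wheelTwelveEdges) (H := extendedWheelGraph 5) wheelTwelveIndex
      (by decide +kernel) (by decide +kernel) (by decide +kernel))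

/-! ### The SR-steps from the common ancestor to the two wheels -/

theorem srStep_splitThirteen_splitTwelve :
    SRStep (routeFinGraph splitThirteenEdges) (routeFinGraph splitTwelveEdges) :=
  -- Vertex 12 is merged with 2, the entry at index 3. The removed vertex has the last label, so
  -- `Fin.castSucc` keeps all other labels.
  srStep_of_map (G := routeGraph splitThirteenEdges) 12 ![3, 4, 8, 2, 1, 11] Fin.castSucc
    (isCrossedStar_iff.2 (by decide +kernel)) (by unfold SRFeasible; decide +kernel)
    (by decide +kernel) (by decide +kernel) (by decide +kernel)

theorem srStep_splitTwelve_splitEleven :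
    SRStep (routeFinGraph splitTwelveEdges) (routeFinGraph splitElevenEdges) :=
  srStep_of_map (G := routeGraph splitTwelveEdges) 11 ![3, 2, 1, 9, 5, 4] Fin.castSucc
    (isCrossedStar_iff.2 (by decide +kernel)) (by unfold SRFeasible; decide +kernel)
    (by decide +kernel) (by decide +kernel) (by decide +kernel)

theorem srStep_splitEleven_XW_four :
    SRStep (routeFinGraph splitElevenEdges) (XW 4) :=
  srStep_of_map (G := routeGraph splitElevenEdges) 10 ![0, 1, 2, 8, 6, 7] (fun w => (wheelTenIndex w).castSucc)
    (isCrossedStar_iff.2 (by decide +kernel)) (by unfold SRFeasible; decide +kernel)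
    (by decide +kernel) (by decide +kernel) (by decide +kernel)

theorem srStep_splitThirteen_XW_five :
    SRStep (routeFinGraph splitThirteenEdges) (XW 5) :=
  srStep_of_map (G := routeGraph splitThirteenEdges) 4 ![3, 11, 5, 6, 8, 12] 
    -- The first ten entries are the rim in cyclic order, the last two the poles. Merging 4 with 6
    -- gives 6 its missing rim neighbours 3, 11, 12.
    (fun w => ![0, 7, 9, 5, 11, 3, 12, 8, 2, 10, 1, 6] (wheelTwelveIndex w))
    (isCrossedStar_iff.2 (by decide +kernel)) (by unfold SRFeasible; decide +kernel)
    (by decide +kernel) (by decide +kernel) (by decide +kernel)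

theorem reflTransGen_splitThirteen {m : ℕ} (hm : m = 4 ∨ m = 5) :
    Relation.ReflTransGen (stepOn IsFiveConnectedOptimal SRStep)
      (routeFinGraph splitThirteenEdges) (XW m) := by
  rcases hm with rfl | rfl
  · exact ((Relation.ReflTransGen.single ⟨isFiveConnectedOptimal_splitThirteen,
      isFiveConnectedOptimal_splitTwelve, srStep_splitThirteen_splitTwelve⟩).tail
      ⟨isFiveConnectedOptimal_splitTwelve, isFiveConnectedOptimal_splitEleven,
        srStep_splitTwelve_splitEleven⟩).tail
      ⟨isFiveConnectedOptimal_splitEleven, isFiveConnectedOptimal_XW_four,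
        srStep_splitEleven_XW_four⟩
  · exact .single ⟨isFiveConnectedOptimal_splitThirteen, isFiveConnectedOptimal_XW_five,
      srStep_splitThirteen_XW_five⟩

/-! ### Distinct irreducible descendants and non-confluence -/

theorem isIrreducible_XW {m : ℕ} (hm : m = 4 ∨ m = 5) : IsIrreducible SRCRStep (XW m) := by
  rcases hm with rfl | rfl
  exacts [isIrreducible_XW_four, isIrreducible_XW_five]

theorem IsIrreducible.eq_of_reflTransGen {C : FinGraph → Prop} {step : FinGraph → FinGraph → Prop}
    {G H : FinGraph} (hG : IsIrreducible step G)
    (h : Relation.ReflTransGen (stepOn C step) G H) : G = H := by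
  rcases h.cases_head with h | ⟨K, hK, -⟩
  exacts [h, (hG K hK.2.2).elim]

theorem not_isConfluent {C : FinGraph → Prop} {step : FinGraph → FinGraph → Prop}
    {G U W : FinGraph} (hU : IsIrreducible step U) (hW : IsIrreducible step W)
    (hGU : Relation.ReflTransGen (stepOn C step) G U)
    (hGW : Relation.ReflTransGen (stepOn C step) G W) (hUW : ¬ U.Iso W) :
    ¬ IsConfluent (stepOn C step) := by
  intro h
  obtain ⟨Z, Z', hZ, hZ', hiso⟩ := h G U W hGU hGW
  rw [← hU.eq_of_reflTransGen hZ, ← hW.eq_of_reflTransGen hZ'] at hiso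
  exact hUW hiso

end OnePlanarReduction

open OnePlanarReduction

theorem mainTheorem10 :
    -- the system with both rules on the optimal 1-planar graphs is not confluent
    (¬ OnePlanarReduction.IsConfluent
        (OnePlanarReduction.stepOn OnePlanarReduction.IsOptimalOnePlanar
          OnePlanarReduction.SRCRStep)) ∧
    -- the system with `SR` alone on the 5-connected optimal 1-planar graphs is not confluent
    (¬ OnePlanarReduction.IsConfluent
        (OnePlanarReduction.stepOn OnePlanarReduction.IsFiveConnectedOptimal
          OnePlanarReduction.SRStep)) ∧
    -- reductions of one graph to two different irreducible extended wheel graphs, for both rules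
    (∃ G : OnePlanarReduction.FinGraph, OnePlanarReduction.IsOptimalOnePlanar G ∧
      ∃ k l : ℕ, 3 ≤ k ∧ 3 ≤ l ∧
        ¬ (OnePlanarReduction.XW k).Iso (OnePlanarReduction.XW l) ∧
        (∀ m : ℕ, m = k ∨ m = l →
          Relation.ReflTransGen
            (OnePlanarReduction.stepOn OnePlanarReduction.IsOptimalOnePlanar
              OnePlanarReduction.SRCRStep) G (OnePlanarReduction.XW m) ∧
          OnePlanarReduction.IsIrreducible OnePlanarReduction.SRCRStep
            (OnePlanarReduction.XW m))) ∧
    -- the same for `SR` alone on 5-connected graphs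
    (∃ G : OnePlanarReduction.FinGraph, OnePlanarReduction.IsFiveConnectedOptimal G ∧
      ∃ k l : ℕ, 3 ≤ k ∧ 3 ≤ l ∧
        ¬ (OnePlanarReduction.XW k).Iso (OnePlanarReduction.XW l) ∧
        (∀ m : ℕ, m = k ∨ m = l →
          Relation.ReflTransGen
            (OnePlanarReduction.stepOn OnePlanarReduction.IsFiveConnectedOptimal
              OnePlanarReduction.SRStep) G (OnePlanarReduction.XW m) ∧
          OnePlanarReduction.IsIrreducible OnePlanarReduction.SRStep
            (OnePlanarReduction.XW m))) := by
  have hne : ¬ (XW 4).Iso (XW 5) := by rw [XW_iso_iff]; decide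
  have hirr : ∀ m, m = 4 ∨ m = 5 → IsIrreducible SRStep (XW m) := fun m hm H h =>
    isIrreducible_XW hm H (Or.inl h)
  have hred : ∀ m, m = 4 ∨ m = 5 → Relation.ReflTransGen (stepOn IsOptimalOnePlanar SRCRStep)
      (routeFinGraph splitThirteenEdges) (XW m) := fun m hm =>
    Relation.ReflTransGen.mono (fun _ _ h => ⟨h.1.1, h.2.1.1, Or.inl h.2.2⟩) _ _
      (reflTransGen_splitThirteen hm)
  refine ⟨?_, ?_, ?_, ?_⟩
  · exact not_isConfluent isIrreducible_XW_four isIrreducible_XW_five (hred 4 (.inl rfl))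
      (hred 5 (.inr rfl)) hne
  · exact not_isConfluent (hirr 4 (.inl rfl)) (hirr 5 (.inr rfl))
      (reflTransGen_splitThirteen (.inl rfl)) (reflTransGen_splitThirteen (.inr rfl)) hne
  · exact ⟨_, isFiveConnectedOptimal_splitThirteen.1, 4, 5, by decide, by decide, hne,
      fun m hm => ⟨hred m hm, isIrreducible_XW hm⟩⟩
  · exact ⟨_, isFiveConnectedOptimal_splitThirteen, 4, 5, by decide, by decide, hne,
      fun m hm => ⟨reflTransGen_splitThirteen hm, hirr m hm⟩⟩
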